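/- **Theorem 1.** Let $\alpha_1<\alpha_2<\alpha_3$ be real numbers, let $\rho_1,\rho_2,\rho_3>0$, put $A(x)=(x-\alpha_1)(x-\alpha_2)(x-\alpha_3)$, and let $k\ge 1$ be an integer. Call a real number $\nu$ a *Van Vleck zero of order $k$* if for some real $\mu\neq 0$ the equation $$S''(x)+\sum_{i=1}^{3}\frac{\rho_i}{x-\alpha_i}\,S'(x)=\frac{\mu\,(x-\nu)}{A(x)}\,S(x)$$ has a real polynomial solution $S$ of degree exactly $k$; such an $S$ is called a *Stieltjes polynomial of degree $k$ belonging to $\nu$*. Then there are exactly $k+1$ Van Vleck zeros of order $k$; write them as $\nu_1^{(k)}<\nu_2^{(k)}<\dots<\nu_{k+1}^{(k)}$. For every $j\in\{1,\dots,k+1\}$ and every Stieltjes polynomial $S_j^{(k)}$ of degree $k$ belonging to $\nu_j^{(k)}$, the polynomial $S_j^{(k)}$ has exactly $j-1$ distinct zeros in $(\alpha_1,\alpha_2)$ and exactly $k-j+1$ distinct zeros in $(\alpha_2,\alpha_3)$ (so all its zeros are simple and lie in these two intervals). Moreover, $S_j^{(k)}$ has no zero between $\alpha_2$ and $\nu_j^{(k)}$,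 that is, no zero in the closed interval with endpoints $\alpha_2$ and $\nu_j^{(k)}$. -/

import Mathlib

open Polynomial

/-- The monic polynomial `A(x) = ∏ j, (x - α j)`. -/
noncomputable def lameA {p : ℕ} (α : Fin p → ℝ) : ℝ[X] :=
  ∏ j, (X - C (α j))

/-- `S` solves the generalized Lamé equation
`S'' + ∑ j, ρ j / (x - α j) * S' = V / A * S` at every real point other than the
singular points `α j`. -/
def SolvesLame {p : ℕ} (α ρ : Fin p → ℝ) (V S : ℝ[X]) : Prop :=
  ∀ x : ℝ, (∀ j, x ≠ α j) →
    S.derivative.derivative.eval x + (∑ j, ρ j / (x - α j)) * S.derivative.eval x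
      = V.eval x / (lameA α).eval x * S.eval x

/-- For `p = 3`: `S` is a Stieltjes polynomial of degree `k` whose Van Vleck polynomial is
a linear polynomial `V(x) = μ (x - ν)` with zero `ν`. -/
def IsStieltjes (α ρ : Fin 3 → ℝ) (k : ℕ) (ν : ℝ) (S : ℝ[X]) : Prop :=
  S.degree = (k : WithBot ℕ) ∧ ∃ μ : ℝ, μ ≠ 0 ∧ SolvesLame α ρ (C μ * (X - C ν)) S

/-- The Van Vleck zeros of order `k`. -/
def vanVleckZeros (α ρ : Fin 3 → ℝ) (k : ℕ) : Set ℝ :=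
  {ν | ∃ S : ℝ[X], IsStieltjes α ρ k ν S}

/-! Multiply by `A` and move the middle singular point to the origin. The Taylor coefficients of `S`
there satisfy a three-term recurrence, i.e. a tridiagonal eigenvalue problem of size `k + 1` with
eigenvalue `μ (ν - α 1)`. The top coefficient forces `μ = k (k - 1) + k (ρ 0 + ρ 1 + ρ 2) > 0`,
which makes all off-diagonal entries positive. Hence there are `k + 1` distinct real eigenvalues,
and at least that many Van Vleck zeros (`exists_vanVleckZeros`).

With `P = ∏ |x - α j| ^ ρ j` the equation reads `(P S')' = P (V / A) S`, and `P` vanishes at every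
singular point. The sign of `A` is constant on each of the two intervals and differs between them,
so Sturm comparison (`ncard_roots_lt_of_wronskian`) shows that, as `ν` grows, the number of zeros
strictly increases on the left and strictly decreases on the right. These numbers lie in `{0, …,
k}`, so there are at most `k + 1` Van Vleck zeros. With exactly `k + 1` of them, monotonicity leaves
only the counts `j` and `k - j` (`j` from `0`).

Finally `(P S S')' = P (S'² + (V / A) S²)`, and `V / A > 0` strictly between `α 1` and `ν`. Since `P
S S'` vanishes at `α 1`, it cannot vanish again up to `ν`, so neither can `S`. At `α 1` itself, `S =
0` would make the recurrence kill every coefficient. -/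

/-! ### Eigenvalues of tridiagonal matrices -/

section Tridiagonal

/-- A solution of a three-term recurrence is determined by its initial value. -/
theorem eq_zero_of_recurrence {k : ℕ} {l u d : ℕ → ℝ} (hl : ∀ m < k, 0 < l m) {c : ℝ}
    {q : ℕ → ℝ} (hq : ∀ m, k < m → q m = 0) (h0 : d 0 * q 0 + l 0 * q 1 = c * q 0)
    (h : ∀ m < k, u m * q m + d (m + 1) * q (m + 1) + l (m + 1) * q (m + 2) = c * q (m + 1))
    (hz : q 0 = 0) : q = 0 := by
  have key : ∀ m, q m = 0 ∧ q (m + 1) = 0 := by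
    intro m
    induction m with
    | zero =>
      refine ⟨hz, ?_⟩
      by_cases hk : 0 < k
      · have : l 0 * q 1 = 0 := by simpa [hz] using h0
        exact (mul_eq_zero.1 this).resolve_left (hl 0 hk).ne'
      · exact hq _ (by omega)
    | succ m ih =>
      refine ⟨ih.2, ?_⟩
      by_cases hk : m + 1 < k
      · have := h m (by omega)
        rw [ih.1, ih.2] at this
        have : l (m + 1) * q (m + 2) = 0 := by simpa using this
        exact (mul_eq_zero.1 this).resolve_left (hl _ hk).ne'
      · exact hq _ (by omega)
  funext m
  exact (key m).1

/-- The entries of the symmetric tridiagonal matrix with diagonal `d` and off-diagonal `s`. -/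
noncomputable def jacobiEntry (d s : ℕ → ℝ) (i j : ℕ) : ℝ :=
  (if j = i then d i else 0) + (if j = i + 1 then s i else 0) + (if i = j + 1 then s j else 0)

theorem jacobiEntry_comm (d s : ℕ → ℝ) (i j : ℕ) : jacobiEntry d s i j = jacobiEntry d s j i := by
  unfold jacobiEntry
  by_cases h : j = i
  · subst h; ring
  · simp only [h, Ne.symm h, if_false]; ring

theorem sum_jacobiEntry_zero (d s v : ℕ → ℝ) (k : ℕ) (hv : ∀ m, k < m → v m = 0) :
    ∑ j ∈ Finset.range (k + 1), jacobiEntry d s 0 j * v j = d 0 * v 0 + s 0 * v 1 := by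
  simp only [jacobiEntry, add_mul, Finset.sum_add_distrib, ite_mul, zero_mul,
    Finset.sum_ite_eq', Finset.mem_range]
  rcases Nat.eq_zero_or_pos k with rfl | hk
  · simp [hv 1]
  · simp [hk]

theorem sum_jacobiEntry_succ (d s v : ℕ → ℝ) (k m : ℕ) (hm : m < k)
    (hv : ∀ m, k < m → v m = 0) :
    ∑ j ∈ Finset.range (k + 1), jacobiEntry d s (m + 1) j * v j =
      s m * v m + d (m + 1) * v (m + 1) + s (m + 1) * v (m + 2) := by
  have e : ∀ j, (m + 1 = j + 1) = (j = m) := fun j => propext (by omega)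
  simp only [jacobiEntry, add_mul, Finset.sum_add_distrib, ite_mul, zero_mul, e,
    Finset.sum_ite_eq', Finset.mem_range]
  rw [if_pos (show m + 1 < k + 1 by omega), if_pos (show m < k + 1 by omega)]
  by_cases h : m + 1 + 1 < k + 1
  · rw [if_pos h]; ring
  · rw [if_neg h, hv (m + 2) (by omega)]; ring

/-- A symmetric tridiagonal matrix of size `k + 1` with positive off-diagonal entries has `k + 1`
distinct real eigenvalues. -/
theorem exists_jacobi_eigenvalues (k : ℕ) (d s : ℕ → ℝ) (hs : ∀ m < k, 0 < s m) :
    ∃ c : Fin (k + 1) → ℝ, Function.Injective c ∧ ∀ i, ∃ q : ℕ → ℝ, q ≠ 0 ∧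
      (∀ m, k < m → q m = 0) ∧ d 0 * q 0 + s 0 * q 1 = c i * q 0 ∧
      ∀ m < k, s m * q m + d (m + 1) * q (m + 1) + s (m + 1) * q (m + 2) = c i * q (m + 1) := by
  let N : Matrix (Fin (k + 1)) (Fin (k + 1)) ℝ := fun i j => jacobiEntry d s i j
  have hN : N.IsHermitian := by
    ext i j
    exact jacobiEntry_comm d s j i
  let v : Fin (k + 1) → ℕ → ℝ := fun i m =>
    if h : m < k + 1 then hN.eigenvectorBasis i ⟨m, h⟩ else 0
  have hvk : ∀ i m, k < m → v i m = 0 := fun i m hm => dif_neg (by omega)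
  have hval : ∀ i (x : Fin (k + 1)), v i x = hN.eigenvectorBasis i x := fun i x =>
    dif_pos x.2
  have hsum : ∀ i m, m < k + 1 →
      ∑ j ∈ Finset.range (k + 1), jacobiEntry d s m j * v i j = hN.eigenvalues i * v i m := by
    intro i m hm
    have h1 := congrFun (hN.mulVec_eigenvectorBasis i) ⟨m, hm⟩
    rw [← Fin.sum_univ_eq_sum_range (fun j => jacobiEntry d s m j * v i j)]
    simp only [hval]
    simpa [Matrix.mulVec, dotProduct, N, v, Nat.lt_succ_iff.1 hm] using h1
  have hzero : ∀ i, d 0 * v i 0 + s 0 * v i 1 = hN.eigenvalues i * v i 0 := fun i => by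
    rw [← sum_jacobiEntry_zero d s (v i) k (hvk i), hsum i 0 (by omega)]
  have hsucc : ∀ i, ∀ m < k, s m * v i m + d (m + 1) * v i (m + 1) + s (m + 1) * v i (m + 2)
      = hN.eigenvalues i * v i (m + 1) := fun i m hm => by
    rw [← sum_jacobiEntry_succ d s (v i) k m hm (hvk i), hsum i _ (by omega)]
  have hne : ∀ i, v i ≠ 0 := by
    intro i h
    apply hN.eigenvectorBasis.orthonormal.ne_zero i
    ext x
    rw [← hval, h]; rfl
  have hne0 : ∀ i, v i 0 ≠ 0 := fun i h =>
    hne i (eq_zero_of_recurrence hs (hvk i) (hzero i) (hsucc i) h)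
  refine ⟨hN.eigenvalues, ?_, fun i => ⟨v i, hne i, hvk i, hzero i, hsucc i⟩⟩
  intro i j hij
  by_contra hne'
  -- Eigenspaces are one-dimensional: this combination has initial value zero, hence vanishes,
  -- against the orthogonality of two basis vectors.
  have hcomb : (fun m => v j 0 * v i m - v i 0 * v j m) = 0 := by
    refine eq_zero_of_recurrence (c := hN.eigenvalues i) (l := s) (u := s) (d := d) hs ?_ ?_ ?_ ?_
    · intro m hm; simp [hvk i m hm, hvk j m hm]
    · have h1 := hzero i
      have h2 := hzero j
      rw [← hij] at h2
      linear_combination v j 0 * h1 - v i 0 * h2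
    · intro m hm
      have h1 := hsucc i m hm
      have h2 := hsucc j m hm
      rw [← hij] at h2
      linear_combination v j 0 * h1 - v i 0 * h2
    · ring
  have hb : v j 0 • hN.eigenvectorBasis i - v i 0 • hN.eigenvectorBasis j = 0 := by
    ext x
    have := congrFun hcomb x
    simpa [hval] using this
  have hin := congrArg (fun y => inner ℝ (hN.eigenvectorBasis i) y) hb
  simp only [inner_sub_right, inner_smul_right, inner_zero_right,
    hN.eigenvectorBasis.orthonormal.2 hne', real_inner_self_eq_norm_sq,
    hN.eigenvectorBasis.orthonormal.1 i] at hin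
  exact hne0 j (by simpa using hin)

/-- A tridiagonal matrix of size `k + 1` with positive off-diagonal entries has `k + 1` distinct
real eigenvalues. -/
theorem exists_tridiagonal_eigenvalues (k : ℕ) (d l u : ℕ → ℝ) (hl : ∀ m < k, 0 < l m)
    (hu : ∀ m < k, 0 < u m) :
    ∃ c : Fin (k + 1) → ℝ, Function.Injective c ∧ ∀ i, ∃ q : ℕ → ℝ, q ≠ 0 ∧
      (∀ m, k < m → q m = 0) ∧ d 0 * q 0 + l 0 * q 1 = c i * q 0 ∧
      ∀ m < k, u m * q m + d (m + 1) * q (m + 1) + l (m + 1) * q (m + 2) = c i * q (m + 1) := by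
  obtain ⟨c, hc, hq⟩ := exists_jacobi_eigenvalues k d (fun m => √(l m * u m))
    (fun m hm => Real.sqrt_pos.2 (mul_pos (hl m hm) (hu m hm)))
  refine ⟨c, hc, fun i => ?_⟩
  obtain ⟨q, hq0, hqk, h0, h1⟩ := hq i
  -- Conjugation by the diagonal matrix `w` turns both off-diagonal entries `l m` and `u m` into
  -- `√(l m * u m)`.
  let w : ℕ → ℝ := fun m => ∏ i ∈ Finset.range m, (√(u i) / √(l i))
  have hw : ∀ m ≤ k, 0 < w m := fun m hm => Finset.prod_pos fun i hi => by
    have := Finset.mem_range.1 hi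
    exact div_pos (Real.sqrt_pos.2 (hu i (by omega))) (Real.sqrt_pos.2 (hl i (by omega)))
  have hws : ∀ m, w (m + 1) = w m * (√(u m) / √(l m)) := fun m => Finset.prod_range_succ _ _
  -- The case `m = k` is needed for the last row; there `l k` has no known sign, but `q (k + 1) =
  -- 0`.
  have hlq : ∀ m ≤ k, l m * (w (m + 1) * q (m + 1)) = w m * (√(l m * u m) * q (m + 1)) := by
    intro m hm
    rcases hm.eq_or_lt with rfl | hm
    · simp [hqk (m + 1) (by omega)]
    · have hlm := Real.sqrt_pos.2 (hl m hm)
      have hsq := Real.mul_self_sqrt (hl m hm).le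
      rw [hws, Real.sqrt_mul (hl m hm).le]
      field_simp
      rw [pow_two, hsq]; ring
  have huq : ∀ m < k, u m * (w m * q m) = w (m + 1) * (√(l m * u m) * q m) := by
    intro m hm
    have hlm := Real.sqrt_pos.2 (hl m hm)
    have hsq := Real.mul_self_sqrt (hu m hm).le
    rw [hws, Real.sqrt_mul (hl m hm).le]
    field_simp
    rw [pow_two, hsq]; ring
  refine ⟨fun m => w m * q m, ?_, fun m hm => by simp [hqk m hm], ?_, ?_⟩
  · intro h
    apply hq0
    funext m
    by_cases hm : m ≤ k
    · exact (mul_eq_zero.1 (congrFun h m)).resolve_left (hw m hm).ne'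
    · exact hqk m (by omega)
  · simp only
    rw [hlq 0 (by omega)]
    linear_combination w 0 * h0
  · intro m hm
    simp only
    rw [hlq (m + 1) (by omega), huq m hm]
    linear_combination w (m + 1) * h1 m hm

end Tridiagonal

/-! ### The integrating factor and two derivative identities -/

section Weight

/-- The weight `∏ j, |x - α j| ^ ρ j`, an integrating factor of the Lamé equation. -/
noncomputable def lameWeight {p : ℕ} (α ρ : Fin p → ℝ) (x : ℝ) : ℝ :=
  ∏ j, |x - α j| ^ ρ j

theorem continuous_lameWeight {p : ℕ} (α ρ : Fin p → ℝ) (hρ : ∀ i, 0 < ρ i) :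
    Continuous (lameWeight α ρ) := by
  unfold lameWeight
  refine continuous_finsetProd _ fun j _ => ?_
  exact Continuous.rpow_const (by fun_prop) fun x => Or.inr (hρ j).le

theorem lameWeight_nonneg {p : ℕ} (α ρ : Fin p → ℝ) (x : ℝ) : 0 ≤ lameWeight α ρ x :=
  Finset.prod_nonneg fun _ _ => Real.rpow_nonneg (abs_nonneg _) _

theorem lameWeight_pos {p : ℕ} (α ρ : Fin p → ℝ) {x : ℝ} (hx : ∀ j, x ≠ α j) :
    0 < lameWeight α ρ x :=
  Finset.prod_pos fun j _ => Real.rpow_pos_of_pos (abs_pos.2 (sub_ne_zero.2 (hx j))) _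

theorem lameWeight_apply_singular {p : ℕ} (α ρ : Fin p → ℝ) (hρ : ∀ i, 0 < ρ i) (j : Fin p) :
    lameWeight α ρ (α j) = 0 :=
  Finset.prod_eq_zero (Finset.mem_univ j) (by simp [Real.zero_rpow (hρ j).ne'])

theorem hasDerivAt_lameWeight {p : ℕ} (α ρ : Fin p → ℝ) {x : ℝ} (hx : ∀ j, x ≠ α j) :
    HasDerivAt (lameWeight α ρ) (lameWeight α ρ x * ∑ j, ρ j / (x - α j)) x := by
  -- `Real.log` ignores the sign of its argument, so one formula serves on all sides of the singular
  -- points.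
  have key : ∀ y, (∀ j, y ≠ α j) →
      lameWeight α ρ y = Real.exp (∑ j, ρ j * Real.log (y - α j)) := by
    intro y hy
    rw [Real.exp_sum]
    refine Finset.prod_congr rfl fun j _ => ?_
    rw [Real.rpow_def_of_pos (abs_pos.2 (sub_ne_zero.2 (hy j))), Real.log_abs, mul_comm]
  have hev : ∀ᶠ y in nhds x, ∀ j, y ≠ α j :=
    Filter.eventually_all.2 fun j => isOpen_ne.mem_nhds (hx j)
  have hd : HasDerivAt (fun y => ∑ j, ρ j * Real.log (y - α j)) (∑ j, ρ j / (x - α j)) x := by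
    refine HasDerivAt.fun_sum fun j _ => ?_
    have := (((hasDerivAt_id x).sub_const (α j)).log (sub_ne_zero.2 (hx j))).const_mul (ρ j)
    simpa [div_eq_mul_inv] using this
  rw [key x hx]
  exact hd.exp.congr_of_eventuallyEq (hev.mono key)

/-- The weighted Wronskian of solutions of two Lamé equations. -/
noncomputable def lameWronskian {p : ℕ} (α ρ : Fin p → ℝ) (f g : ℝ[X]) (x : ℝ) : ℝ :=
  lameWeight α ρ x * (f.derivative.eval x * g.eval x - f.eval x * g.derivative.eval x)

/-- Lagrange's identity for the self-adjoint form `(P f')' = P (U / A) f`: the terms in `f' g'`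
cancel. -/
theorem hasDerivAt_lameWronskian {p : ℕ} {α ρ : Fin p → ℝ} {U V f g : ℝ[X]}
    (hf : SolvesLame α ρ U f) (hg : SolvesLame α ρ V g) {x : ℝ} (hx : ∀ j, x ≠ α j) :
    HasDerivAt (lameWronskian α ρ f g)
      (lameWeight α ρ x * ((U.eval x - V.eval x) / (lameA α).eval x) * (f.eval x * g.eval x)) x := by
  have hW := (hasDerivAt_lameWeight α ρ hx).mul
    (((f.derivative.hasDerivAt x).mul (g.hasDerivAt x)).sub
      ((f.hasDerivAt x).mul (g.derivative.hasDerivAt x)))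
  refine hW.congr_deriv ?_
  have h1 := hf x hx
  have h2 := hg x hx
  simp only [Pi.mul_apply, Pi.sub_apply]
  rw [sub_div]
  linear_combination lameWeight α ρ x * (g.eval x * h1 - f.eval x * h2)

theorem hasDerivAt_weight_mul_self_mul_derivative {p : ℕ} {α ρ : Fin p → ℝ} {V f : ℝ[X]}
    (hf : SolvesLame α ρ V f) {x : ℝ} (hx : ∀ j, x ≠ α j) :
    HasDerivAt (fun y => lameWeight α ρ y * (f.eval y * f.derivative.eval y))
      (lameWeight α ρ x *
        (f.derivative.eval x ^ 2 + V.eval x / (lameA α).eval x * f.eval x ^ 2)) x := by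
  have hW := (hasDerivAt_lameWeight α ρ hx).mul
    ((f.hasDerivAt x).mul (f.derivative.hasDerivAt x))
  refine hW.congr_deriv ?_
  have h1 := hf x hx
  simp only [Pi.mul_apply]
  linear_combination lameWeight α ρ x * f.eval x * h1

end Weight

/-! ### Sturm comparison with endpoints where the weight vanishes -/

section Comparison

/-- A polynomial without zeros in an open interval has, up to a factor `±1`, positive values
there. -/
theorem exists_sign_of_ne_zero {a b : ℝ} (hab : a < b) (f : ℝ[X])
    (hf : ∀ x ∈ Set.Ioo a b, f.eval x ≠ 0) :
    ∃ e : ℝ, (e = 1 ∨ e = -1) ∧ ∀ x ∈ Set.Ioo a b, 0 < (C e * f).eval x := by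
  obtain ⟨c, hc⟩ := Set.nonempty_Ioo.2 hab
  have hconst : ∀ x ∈ Set.Ioo a b, 0 < f.eval c * f.eval x := by
    intro x hx
    by_contra hle
    have hcont : ContinuousOn (fun y => f.eval c * f.eval y) (Set.Ioo a b) := by fun_prop
    have hc0 : 0 ≤ f.eval c * f.eval c := mul_self_nonneg _
    obtain ⟨y, hy, hy0⟩ := isPreconnected_Ioo.intermediate_value hx hc hcont
      ⟨not_lt.1 hle, hc0⟩
    rcases mul_eq_zero.1 hy0 with h | h
    · exact hf c hc h
    · exact hf y hy h
  rcases lt_or_gt_of_ne (hf c hc) with h | h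
  · refine ⟨-1, Or.inr rfl, fun x hx => ?_⟩
    have := hconst x hx
    simp only [eval_mul, eval_C]
    nlinarith
  · refine ⟨1, Or.inl rfl, fun x hx => ?_⟩
    have := hconst x hx
    simp only [eval_mul, eval_C]
    nlinarith

theorem eval_nonneg_of_pos_Ioo {a b : ℝ} (hab : a < b) {f : ℝ[X]}
    (hf : ∀ x ∈ Set.Ioo a b, 0 < f.eval x) {x : ℝ} (hx : x ∈ Set.Icc a b) : 0 ≤ f.eval x := by
  rw [← closure_Ioo hab.ne] at hx
  exact closure_minimal (fun y hy => (hf y hy).le)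
    (isClosed_le continuous_const f.continuous) hx

theorem derivative_eval_nonneg_left {a b : ℝ} (hab : a < b) {f : ℝ[X]}
    (hf : ∀ x ∈ Set.Ioo a b, 0 < f.eval x) (ha : f.eval a = 0) : 0 ≤ f.derivative.eval a := by
  have h := (hasDerivWithinAt_iff_tendsto_slope' (s := Set.Ioi a) (by simp)).1
    (f.hasDerivAt a).hasDerivWithinAt
  refine ge_of_tendsto h ?_
  filter_upwards [Ioo_mem_nhdsGT hab] with x hx
  rw [slope_def_field, ha, sub_zero]
  exact div_nonneg (hf x hx).le (sub_nonneg.2 hx.1.le)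

theorem derivative_eval_nonpos_right {a b : ℝ} (hab : a < b) {f : ℝ[X]}
    (hf : ∀ x ∈ Set.Ioo a b, 0 < f.eval x) (hb : f.eval b = 0) : f.derivative.eval b ≤ 0 := by
  have h := (hasDerivWithinAt_iff_tendsto_slope' (s := Set.Iio b) (by simp)).1
    (f.hasDerivAt b).hasDerivWithinAt
  refine le_of_tendsto h ?_
  filter_upwards [Ioo_mem_nhdsLT hab] with x hx
  rw [slope_def_field, hb, sub_zero]
  exact div_nonpos_of_nonneg_of_nonpos (hf x hx).le (sub_nonpos.2 hx.2.le)

/-- Sturm comparison on an interval at each end of which the weight `P` or `f` vanishes. -/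
theorem exists_zero_of_wronskian {a b : ℝ} (hab : a < b) {P r : ℝ → ℝ} (hP : Continuous P)
    (hP0 : ∀ x, 0 ≤ P x) (hr : ∀ x ∈ Set.Ioo a b, 0 < r x) {f g : ℝ[X]}
    (hW : ∀ x ∈ Set.Ioo a b, HasDerivAt
      (fun y => P y * (f.derivative.eval y * g.eval y - f.eval y * g.derivative.eval y))
      (r x * (f.eval x * g.eval x)) x)
    (ha : P a = 0 ∨ f.eval a = 0) (hb : P b = 0 ∨ f.eval b = 0)
    (hf : ∀ x ∈ Set.Ioo a b, f.eval x ≠ 0) :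
    ∃ x ∈ Set.Ioo a b, g.eval x = 0 := by
  by_contra! hg
  obtain ⟨s, hs, hfs⟩ := exists_sign_of_ne_zero hab f hf
  obtain ⟨t, ht, hgt⟩ := exists_sign_of_ne_zero hab g hg
  set W : ℝ → ℝ := fun y =>
    P y * (f.derivative.eval y * g.eval y - f.eval y * g.derivative.eval y) with hWdef
  -- After normalising signs, `f, g > 0` makes `W` strictly increasing, while the boundary
  -- conditions give `W a ≥ 0 ≥ W b`.
  have hmono : StrictMonoOn (fun y => s * t * W y) (Set.Icc a b) := by
    refine strictMonoOn_of_deriv_pos (convex_Icc a b) ?_ ?_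
    · simp only [hWdef]; fun_prop
    · intro x hx
      rw [interior_Icc] at hx
      rw [((hW x hx).const_mul (s * t)).deriv]
      have h1 := hfs x hx
      have h2 := hgt x hx
      simp only [eval_mul, eval_C] at h1 h2
      have := mul_pos (hr x hx) (mul_pos h1 h2)
      linarith
  have hlt := hmono (Set.left_mem_Icc.2 hab.le) (Set.right_mem_Icc.2 hab.le) hab
  have hWa : 0 ≤ s * t * W a := by
    rcases ha with h | h
    · simp [hWdef, h]
    · have h1 := derivative_eval_nonneg_left hab hfs (by simp [h])
      have h2 := eval_nonneg_of_pos_Ioo hab hgt (Set.left_mem_Icc.2 hab.le)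
      simp only [derivative_C_mul, eval_mul, eval_C] at h1 h2
      have := mul_nonneg (hP0 a) (mul_nonneg h1 h2)
      simp only [hWdef, h]
      linarith
  have hWb : s * t * W b ≤ 0 := by
    rcases hb with h | h
    · simp [hWdef, h]
    · have h1 := derivative_eval_nonpos_right hab hfs (by simp [h])
      have h2 := eval_nonneg_of_pos_Ioo hab hgt (Set.right_mem_Icc.2 hab.le)
      simp only [derivative_C_mul, eval_mul, eval_C] at h1 h2
      have := mul_nonpos_of_nonneg_of_nonpos (hP0 b) (mul_nonpos_of_nonpos_of_nonneg h1 h2)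
      simp only [hWdef, h]
      linarith
  simp only at hlt
  linarith

theorem finite_roots_Ioo {f : ℝ[X]} (hf : f ≠ 0) (a b : ℝ) :
    {x ∈ Set.Ioo a b | f.IsRoot x}.Finite :=
  (finite_setOfPred_isRoot hf).subset fun _ hx => hx.2

theorem ncard_roots_Ioo_le {f : ℝ[X]} (hf : f ≠ 0) (a b : ℝ) :
    {x ∈ Set.Ioo a b | f.IsRoot x}.ncard ≤ f.natDegree := by
  have hsub : {x ∈ Set.Ioo a b | f.IsRoot x} ⊆ (f.roots.toFinset : Set ℝ) := fun x hx => by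
    simpa [hf] using hx.2
  calc _ ≤ (f.roots.toFinset : Set ℝ).ncard := Set.ncard_le_ncard hsub (Finset.finite_toSet _)
    _ = f.roots.toFinset.card := Set.ncard_coe_finset _
    _ ≤ Multiset.card f.roots := Multiset.toFinset_card_le _
    _ ≤ f.natDegree := card_roots' f

/-- Sturm comparison on an interval at whose ends the weight `P` vanishes: the solution of the
more oscillating equation has at least one more zero. -/
theorem ncard_roots_lt_of_wronskian {a b : ℝ} (hab : a < b) {P r : ℝ → ℝ} (hP : Continuous P)
    (hP0 : ∀ x, 0 ≤ P x) (hr : ∀ x ∈ Set.Ioo a b, 0 < r x) {f g : ℝ[X]} (hf : f ≠ 0) (hg : g ≠ 0)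
    (hW : ∀ x ∈ Set.Ioo a b, HasDerivAt
      (fun y => P y * (f.derivative.eval y * g.eval y - f.eval y * g.derivative.eval y))
      (r x * (f.eval x * g.eval x)) x)
    (ha : P a = 0) (hb : P b = 0) :
    {x ∈ Set.Ioo a b | f.IsRoot x}.ncard < {x ∈ Set.Ioo a b | g.IsRoot x}.ncard := by
  classical
  have hF := finite_roots_Ioo hf a b
  have hG := finite_roots_Ioo hg a b
  rw [Set.ncard_eq_toFinset_card _ hF, Set.ncard_eq_toFinset_card _ hG]
  have ha' : a ∉ insert b hF.toFinset := by simp [hab.ne]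
  have hb' : b ∉ hF.toFinset := by simp
  have hcard : (insert a (insert b hF.toFinset)).card = hF.toFinset.card + 2 := by
    rw [Finset.card_insert_of_notMem ha', Finset.card_insert_of_notMem hb']
  have hend : ∀ x ∈ insert a (insert b hF.toFinset),
      x ∈ Set.Icc a b ∧ (P x = 0 ∨ f.eval x = 0) := by
    intro x hx
    simp only [Finset.mem_insert, Set.Finite.mem_toFinset, Set.mem_ofPred_eq] at hx
    rcases hx with rfl | rfl | hx
    · exact ⟨Set.left_mem_Icc.2 hab.le, Or.inl ha⟩
    · exact ⟨Set.right_mem_Icc.2 hab.le, Or.inl hb⟩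
    · exact ⟨Set.Ioo_subset_Icc_self hx.1, Or.inr hx.2⟩
  -- Both endpoints act as zeros of `f`: its `n` zeros yield `n + 2` points, hence `n + 1` gaps,
  -- each containing a zero of `g`.
  have hle : (insert a (insert b hF.toFinset)).card ≤ hG.toFinset.card + 1 := by
    refine Finset.card_le_of_interleaved fun x hx y hy hxy hno => ?_
    obtain ⟨hxI, hxe⟩ := hend x hx
    obtain ⟨hyI, hye⟩ := hend y hy
    have hsub : Set.Ioo x y ⊆ Set.Ioo a b := Set.Ioo_subset_Ioo hxI.1 hyI.2
    obtain ⟨z, hz, hz0⟩ := exists_zero_of_wronskian hxy hP hP0 (fun z hz => hr z (hsub hz))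
      (fun z hz => hW z (hsub hz)) hxe hye (fun z hz h0 => hno z
        (by simpa [h0] using Or.inr (Or.inr (hsub hz))) hz)
    exact ⟨z, by simpa [hz0] using hsub hz, hz.1, hz.2⟩
  omega

end Comparison

/-! ### From the differential equation to a three-term recurrence -/

section Recurrence

/-- The polynomial `A(x) ∑ j, ρ j / (x - α j)` for three singular points. -/
noncomputable def lameB (α ρ : Fin 3 → ℝ) : ℝ[X] :=
  C (ρ 0) * ((X - C (α 1)) * (X - C (α 2))) + C (ρ 1) * ((X - C (α 0)) * (X - C (α 2))) +
    C (ρ 2) * ((X - C (α 0)) * (X - C (α 1)))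

theorem lameA_eval (α : Fin 3 → ℝ) (x : ℝ) :
    (lameA α).eval x = (x - α 0) * (x - α 1) * (x - α 2) := by
  simp [lameA, Fin.prod_univ_three]

/-- Clearing denominators loses nothing: a polynomial identity valid off finitely many points holds
everywhere. -/
theorem solvesLame_iff (α ρ : Fin 3 → ℝ) (V S : ℝ[X]) :
    SolvesLame α ρ V S ↔
      lameA α * derivative (derivative S) + lameB α ρ * derivative S = V * S := by
  have hpt : ∀ x, (∀ j, x ≠ α j) →
      ((derivative (derivative S)).eval x + (∑ j, ρ j / (x - α j)) * (derivative S).eval x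
        = V.eval x / (lameA α).eval x * S.eval x ↔
      (lameA α * derivative (derivative S) + lameB α ρ * derivative S).eval x =
        (V * S).eval x) := by
    intro x hx
    have h0 := sub_ne_zero.2 (hx 0)
    have h1 := sub_ne_zero.2 (hx 1)
    have h2 := sub_ne_zero.2 (hx 2)
    have hA : (lameA α).eval x ≠ 0 := by rw [lameA_eval]; positivity
    have hB : (lameB α ρ).eval x = (lameA α).eval x * ∑ j, ρ j / (x - α j) := by
      rw [lameA_eval, Fin.sum_univ_three]
      simp only [lameB, eval_add, eval_mul, eval_sub, eval_X, eval_C]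
      field_simp
    rw [eval_add, eval_mul, eval_mul, eval_mul, hB, div_mul_eq_mul_div, eq_div_iff hA]
    constructor <;> intro h <;> linear_combination h
  constructor
  · intro h
    refine eq_of_infinite_eval_eq _ _ ((Set.finite_range α).infinite_compl.mono fun x hx => ?_)
    have hx' : ∀ j, x ≠ α j := fun j hj => hx ⟨j, hj.symm⟩
    exact (hpt x hx').1 (h x hx')
  · intro h x hx
    rw [hpt x hx, h]

theorem coeff_euler_one (Q : ℝ[X]) (m : ℕ) :
    (X * derivative Q).coeff m = m * Q.coeff m := by
  cases m with
  | zero => simp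
  | succ m => rw [coeff_X_mul, coeff_derivative]; push_cast; ring

theorem coeff_X_mul_derivative_two (Q : ℝ[X]) (m : ℕ) :
    (X * derivative (derivative Q)).coeff m = (m + 1) * m * Q.coeff (m + 1) := by
  rw [coeff_euler_one, coeff_derivative]; ring

theorem coeff_euler_two (Q : ℝ[X]) (m : ℕ) :
    (X * (X * derivative (derivative Q))).coeff m = m * (m - 1) * Q.coeff m := by
  cases m with
  | zero => simp
  | succ m => rw [coeff_X_mul, coeff_X_mul_derivative_two]; push_cast; ring

/-- Comparison of coefficients in a Lamé equation with a singular point at the origin. -/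
theorem shifted_lame_iff (a b β R r μ c : ℝ) (Q : ℝ[X]) :
    (X * ((X + C a) * (X - C b)) * derivative (derivative Q) +
        (C R * X ^ 2 + C β * X - C (a * b * r)) * derivative Q = (C μ * X - C c) * Q) ↔
      (-((a - b) * ((0 : ℕ) * ((0 : ℕ) - 1)) + β * (0 : ℕ)) * Q.coeff 0 +
          a * b * (((0 : ℕ) + 1) * ((0 : ℕ) + r)) * Q.coeff 1 = c * Q.coeff 0) ∧
      ∀ m : ℕ, (μ - m * (m - 1) - m * R) * Q.coeff m +
        -((a - b) * ((m + 1 : ℕ) * ((m + 1 : ℕ) - 1)) + β * (m + 1 : ℕ)) * Q.coeff (m + 1) +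
        a * b * (((m + 1 : ℕ) + 1) * ((m + 1 : ℕ) + r)) * Q.coeff (m + 2)
          = c * Q.coeff (m + 1) := by
  -- Terms are sorted by their effect on degree: the three groups raise it by one, preserve it, and
  -- lower it by one.
  have hE : (X * ((X + C a) * (X - C b)) * derivative (derivative Q) +
        (C R * X ^ 2 + C β * X - C (a * b * r)) * derivative Q = (C μ * X - C c) * Q) ↔
      X * (X * (X * derivative (derivative Q)) + C R * (X * derivative Q) - C μ * Q) +
        C (a - b) * (X * (X * derivative (derivative Q))) + C β * (X * derivative Q) + C c * Q
        - C (a * b) * (X * derivative (derivative Q) + C r * derivative Q) = 0 := by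
    simp only [C_mul, C_sub]
    constructor <;> intro h <;> linear_combination h
  rw [hE, Polynomial.ext_iff]
  have h0 : ∀ P : ℝ[X], (X * P).coeff 0 = 0 := fun P => by simp
  constructor
  · intro h
    refine ⟨?_, fun m => ?_⟩
    · have := h 0
      simp only [coeff_add, coeff_sub, coeff_C_mul, coeff_euler_two, coeff_euler_one,
        coeff_derivative, coeff_zero] at this
      rw [mul_coeff_zero] at this
      simp at this ⊢
      linear_combination -this
    · have := h (m + 1)
      simp only [coeff_add, coeff_sub, coeff_C_mul, coeff_euler_two, coeff_euler_one,
        coeff_derivative, coeff_zero] at this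
      rw [coeff_X_mul] at this
      simp only [coeff_add, coeff_sub, coeff_C_mul, coeff_euler_two, coeff_euler_one] at this
      push_cast at this ⊢
      linear_combination -this
  · rintro ⟨hz, hs⟩ m
    cases m with
    | zero =>
      simp only [coeff_add, coeff_sub, coeff_C_mul, coeff_euler_two, coeff_euler_one,
        coeff_derivative, coeff_zero]
      rw [mul_coeff_zero]
      simp at hz ⊢
      linear_combination -hz
    | succ m =>
      have := hs m
      simp only [coeff_add, coeff_sub, coeff_C_mul, coeff_euler_two, coeff_euler_one,
        coeff_derivative, coeff_zero]
      rw [coeff_X_mul]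
      simp only [coeff_add, coeff_sub, coeff_C_mul, coeff_euler_two, coeff_euler_one]
      push_cast at this ⊢
      linear_combination -this

/-- The linear coefficient of `lameB` at the middle singular point. -/
noncomputable def lameBeta (α ρ : Fin 3 → ℝ) : ℝ :=
  -(α 2 - α 1) * ρ 0 + ((α 1 - α 0) - (α 2 - α 1)) * ρ 1 + (α 1 - α 0) * ρ 2

/-- The Lamé equation with the middle singular point moved to the origin. -/
theorem solvesLame_iff_shifted (α ρ : Fin 3 → ℝ) (μ ν : ℝ) (S : ℝ[X]) :
    SolvesLame α ρ (C μ * (X - C ν)) S ↔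
      X * ((X + C (α 1 - α 0)) * (X - C (α 2 - α 1))) *
          derivative (derivative (S.comp (X + C (α 1)))) +
        (C (ρ 0 + ρ 1 + ρ 2) * X ^ 2 + C (lameBeta α ρ) * X
          - C ((α 1 - α 0) * (α 2 - α 1) * ρ 1)) * derivative (S.comp (X + C (α 1)))
        = (C μ * X - C (μ * (ν - α 1))) * S.comp (X + C (α 1)) := by
  have hinj : Function.Injective fun P : ℝ[X] => P.comp (X + C (α 1)) := by
    intro P Q h
    have := congrArg (fun P : ℝ[X] => P.comp (X - C (α 1))) h
    simpa [comp_assoc] using this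
  rw [solvesLame_iff, ← hinj.eq_iff]
  simp only [derivative_comp, lameA, lameB, lameBeta, Fin.prod_univ_three, mul_comp, add_comp,
    sub_comp, X_comp, C_comp, derivative_add, derivative_X, derivative_C, add_zero, one_mul,
    C_add, C_mul, C_sub, C_neg]
  constructor <;> intro h <;> linear_combination h

end Recurrence

/-! ### Existence of `k + 1` Van Vleck zeros -/

section Stieltjes

variable {α ρ : Fin 3 → ℝ} {k : ℕ}

theorem IsStieltjes.ne_zero {ν : ℝ} {S : ℝ[X]} (h : IsStieltjes α ρ k ν S) : S ≠ 0 := by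
  rintro rfl
  simpa using h.1

theorem degree_comp_X_add_C (S : ℝ[X]) (a : ℝ) : (S.comp (X + C a)).degree = S.degree := by
  rw [← taylor_apply, degree_taylor]

/-- In the recurrence at index `k` only the leading coefficient survives, so its factor must vanish.
-/
theorem lame_mu_eq {μ ν : ℝ} {S : ℝ[X]} (hS : S.degree = k)
    (h : SolvesLame α ρ (C μ * (X - C ν)) S) : μ = k * (k - 1) + k * (ρ 0 + ρ 1 + ρ 2) := by
  have hrec := ((shifted_lame_iff _ _ _ _ _ _ _ _).1 ((solvesLame_iff_shifted α ρ μ ν S).1 h)).2 k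
  have hd := (degree_comp_X_add_C S (α 1)).trans hS
  have hk := coeff_ne_zero_of_eq_degree hd
  have h1 : (S.comp (X + C (α 1))).coeff (k + 1) = 0 :=
    coeff_eq_zero_of_degree_lt (by rw [hd]; exact_mod_cast Nat.lt_succ_self k)
  have h2 : (S.comp (X + C (α 1))).coeff (k + 2) = 0 :=
    coeff_eq_zero_of_degree_lt (by rw [hd]; exact_mod_cast (by omega : k < k + 2))
  rw [h1, h2] at hrec
  have : (μ - k * (k - 1) - k * (ρ 0 + ρ 1 + ρ 2)) * (S.comp (X + C (α 1))).coeff k = 0 := by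
    linear_combination hrec
  have := (mul_eq_zero.1 this).resolve_right hk
  linear_combination this

/-- Positivity of the entries below the diagonal; the case `m = 0` gives `μ > 0`. -/
theorem lame_mu_lt (hρ : ∀ i, 0 < ρ i) {m : ℕ} (hm : m < k) :
    0 < (k * (k - 1) + k * (ρ 0 + ρ 1 + ρ 2) : ℝ) - m * (m - 1) - m * (ρ 0 + ρ 1 + ρ 2) := by
  have hR : 0 < ρ 0 + ρ 1 + ρ 2 := by have := hρ 0; have := hρ 1; have := hρ 2; positivity
  have h1 : (m : ℝ) + 1 ≤ k := by exact_mod_cast hm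
  have h2 : (0 : ℝ) ≤ m := m.cast_nonneg
  have h3 : (k * (k - 1) + k * (ρ 0 + ρ 1 + ρ 2) : ℝ) - m * (m - 1) - m * (ρ 0 + ρ 1 + ρ 2)
    = (k - m) * (k + m - 1 + (ρ 0 + ρ 1 + ρ 2)) := by ring
  rw [h3]
  exact mul_pos (by linarith) (by linarith)

theorem lame_lower_pos (hα : StrictMono α) (hρ : ∀ i, 0 < ρ i) (m : ℕ) :
    0 < (α 1 - α 0) * (α 2 - α 1) * (((m : ℝ) + 1) * (m + ρ 1)) := by
  have h1 : 0 < α 1 - α 0 := sub_pos.2 (hα (by decide))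
  have h2 : 0 < α 2 - α 1 := sub_pos.2 (hα (by decide))
  have := hρ 1
  positivity

/-- A Stieltjes polynomial does not vanish at the middle singular point. -/
theorem IsStieltjes.eval_middle_ne_zero (hα : StrictMono α) (hρ : ∀ i, 0 < ρ i) {ν : ℝ} {S : ℝ[X]}
    (h : IsStieltjes α ρ k ν S) : S.eval (α 1) ≠ 0 := by
  intro h0
  obtain ⟨hd, μ, -, hS⟩ := h
  obtain ⟨hz, hs⟩ := (shifted_lame_iff _ _ _ _ _ _ _ _).1 ((solvesLame_iff_shifted α ρ μ ν S).1 hS)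
  have hd' := (degree_comp_X_add_C S (α 1)).trans hd
  refine coeff_ne_zero_of_eq_degree hd' (congrFun (eq_zero_of_recurrence (k := k)
    (l := fun m : ℕ => (α 1 - α 0) * (α 2 - α 1) * (((m : ℝ) + 1) * (m + ρ 1)))
    (d := fun m : ℕ => -(((α 1 - α 0) - (α 2 - α 1)) * ((m : ℝ) * (m - 1)) + lameBeta α ρ * m))
    (fun m _ => lame_lower_pos hα hρ m)
    (fun m hm => coeff_eq_zero_of_degree_lt (by rw [hd']; exact_mod_cast hm)) hz
    (fun m _ => hs m) ?_) k)
  rw [coeff_zero_eq_eval_zero, eval_comp]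
  simpa using h0

/-- An eigenvector is the coefficient sequence of a solution expanded at `α 1`; solving `c = μ (ν -
α 1)` turns its eigenvalue into `ν = α 1 + c / μ`. -/
theorem exists_vanVleckZeros (hα : StrictMono α) (hρ : ∀ i, 0 < ρ i) (hk : 1 ≤ k) :
    ∃ ν : Fin (k + 1) → ℝ, Function.Injective ν ∧ ∀ i, ν i ∈ vanVleckZeros α ρ k := by
  set μ : ℝ := k * (k - 1) + k * (ρ 0 + ρ 1 + ρ 2) with hμdef
  have hμ : 0 < μ := by simpa using lame_mu_lt hρ (m := 0) hk
  obtain ⟨c, hc, hq⟩ := exists_tridiagonal_eigenvalues k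
    (fun m : ℕ => -(((α 1 - α 0) - (α 2 - α 1)) * ((m : ℝ) * (m - 1)) + lameBeta α ρ * m))
    (fun m : ℕ => (α 1 - α 0) * (α 2 - α 1) * (((m : ℝ) + 1) * (m + ρ 1)))
    (fun m : ℕ => μ - m * (m - 1) - m * (ρ 0 + ρ 1 + ρ 2))
    (fun m _ => lame_lower_pos hα hρ m) (fun m hm => lame_mu_lt hρ hm)
  refine ⟨fun i => α 1 + c i / μ, fun i j hij => hc ?_, fun i => ?_⟩
  · have : c i / μ = c j / μ := add_left_cancel hij
    exact (div_left_inj' hμ.ne').1 this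
  obtain ⟨q, hq0, hqk, hz, hs⟩ := hq i
  let Q : ℝ[X] := ∑ m ∈ Finset.range (k + 1), monomial m (q m)
  have hQ : ∀ m, Q.coeff m = q m := by
    intro m
    simp only [Q, finsetSum_coeff, coeff_monomial, Finset.sum_ite_eq', Finset.mem_range]
    split_ifs with h
    · rfl
    · exact (hqk m (by omega)).symm
  have hs' : ∀ m : ℕ, (μ - m * (m - 1) - m * (ρ 0 + ρ 1 + ρ 2)) * Q.coeff m +
      -(((α 1 - α 0) - (α 2 - α 1)) * ((m + 1 : ℕ) * ((m + 1 : ℕ) - 1)) +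
        lameBeta α ρ * (m + 1 : ℕ)) * Q.coeff (m + 1) +
      (α 1 - α 0) * (α 2 - α 1) * (((m + 1 : ℕ) + 1) * ((m + 1 : ℕ) + ρ 1)) * Q.coeff (m + 2)
        = c i * Q.coeff (m + 1) := by
    intro m
    simp only [hQ]
    -- Below `k` this is the eigenvector equation; at `k` the value of `μ` kills the only remaining
    -- term; above `k` all terms vanish.
    rcases lt_trichotomy m k with h | rfl | h
    · exact hs m h
    · rw [hqk (m + 1) (by omega), hqk (m + 2) (by omega), hμdef]; ring
    · rw [hqk m h, hqk (m + 1) (by omega), hqk (m + 2) (by omega)]; ring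
  have hQ0 : Q ≠ 0 := by
    intro h
    apply hq0
    funext m
    rw [← hQ, h]; rfl
  have hdeg : Q.natDegree = k := by
    have hle : Q.natDegree ≤ k := natDegree_le_iff_coeff_eq_zero.2 fun m hm => by
      rw [hQ, hqk m hm]
    -- In a smaller degree, the recurrence at that index would read: positive factor times leading
    -- coefficient equals zero.
    refine hle.eq_or_lt.resolve_right fun hlt => ?_
    have h := hs' Q.natDegree
    rw [coeff_eq_zero_of_natDegree_lt (Nat.lt_succ_self _),
      coeff_eq_zero_of_natDegree_lt (by omega : Q.natDegree < Q.natDegree + 2)] at h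
    have h2 : Q.coeff Q.natDegree ≠ 0 := leadingCoeff_ne_zero.2 hQ0
    have h3 : (μ - Q.natDegree * (Q.natDegree - 1) - Q.natDegree * (ρ 0 + ρ 1 + ρ 2)) *
        Q.coeff Q.natDegree = 0 := by linear_combination h
    exact (lame_mu_lt hρ hlt).ne' ((mul_eq_zero.1 h3).resolve_right h2)
  have hcomp : (Q.comp (X + C (-α 1))).comp (X + C (α 1)) = Q := by simp [comp_assoc]
  refine ⟨Q.comp (X + C (-α 1)), ?_, μ, hμ.ne', ?_⟩
  · rw [degree_comp_X_add_C, degree_eq_natDegree hQ0, hdeg]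
  · rw [solvesLame_iff_shifted, hcomp]
    have hcc : μ * (α 1 + c i / μ - α 1) = c i := by field_simp; ring
    rw [hcc]
    refine (shifted_lame_iff _ _ _ _ _ _ _ _).2 ⟨?_, hs'⟩
    simp only [hQ]
    exact hz

end Stieltjes

/-! ### Counting and locating the zeros -/

section Zeros

variable {α ρ : Fin 3 → ℝ} {k : ℕ}

theorem IsStieltjes.solvesLame {ν : ℝ} {S : ℝ[X]} (h : IsStieltjes α ρ k ν S) :
    SolvesLame α ρ (C (k * (k - 1) + k * (ρ 0 + ρ 1 + ρ 2) : ℝ) * (X - C ν)) S := by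
  obtain ⟨hd, μ, -, hS⟩ := h
  rwa [← lame_mu_eq hd hS]

theorem IsStieltjes.natDegree_eq {ν : ℝ} {S : ℝ[X]} (h : IsStieltjes α ρ k ν S) :
    S.natDegree = k := natDegree_eq_of_degree_eq_some h.1

theorem lameA_eval_pos (hα : StrictMono α) {x : ℝ} (hx : x ∈ Set.Ioo (α 0) (α 1)) :
    0 < (lameA α).eval x := by
  have : α 1 < α 2 := hα (by decide)
  rw [lameA_eval]
  exact mul_pos_of_neg_of_neg (mul_neg_of_pos_of_neg (by linarith [hx.1]) (by linarith [hx.2]))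
    (by linarith [hx.2])

theorem lameA_eval_neg (hα : StrictMono α) {x : ℝ} (hx : x ∈ Set.Ioo (α 1) (α 2)) :
    (lameA α).eval x < 0 := by
  have : α 0 < α 1 := hα (by decide)
  rw [lameA_eval]
  exact mul_neg_of_pos_of_neg (mul_pos (by linarith [hx.1]) (by linarith [hx.1]))
    (by linarith [hx.2])

theorem ne_singular_of_lameA_eval_ne_zero {x : ℝ} (hx : (lameA α).eval x ≠ 0) (j : Fin 3) :
    x ≠ α j := by
  rintro rfl
  refine hx ?_
  rw [lameA, eval_prod]
  exact Finset.prod_eq_zero (Finset.mem_univ j) (by simp)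

/-- The number of zeros in the left interval increases strictly with the Van Vleck zero. -/
theorem ncard_roots_left_lt (hα : StrictMono α) (hρ : ∀ i, 0 < ρ i) (hk : 1 ≤ k) {ν ν' : ℝ}
    (hν : ν < ν') {S T : ℝ[X]} (hS : IsStieltjes α ρ k ν S) (hT : IsStieltjes α ρ k ν' T) :
    {x ∈ Set.Ioo (α 0) (α 1) | S.IsRoot x}.ncard <
      {x ∈ Set.Ioo (α 0) (α 1) | T.IsRoot x}.ncard := by
  have hμ : (0 : ℝ) < k * (k - 1) + k * (ρ 0 + ρ 1 + ρ 2) := by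
    simpa using lame_mu_lt hρ (m := 0) hk
  refine ncard_roots_lt_of_wronskian (hα (by decide)) (continuous_lameWeight α ρ hρ)
    (lameWeight_nonneg α ρ) ?_ hS.ne_zero hT.ne_zero
    (fun x hx => hasDerivAt_lameWronskian hS.solvesLame hT.solvesLame
      (ne_singular_of_lameA_eval_ne_zero (lameA_eval_pos hα hx).ne'))
    (lameWeight_apply_singular α ρ hρ 0) (lameWeight_apply_singular α ρ hρ 1)
  intro x hx
  have hA := lameA_eval_pos hα hx
  refine mul_pos (lameWeight_pos α ρ (ne_singular_of_lameA_eval_ne_zero hA.ne')) (div_pos ?_ hA)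
  simp only [eval_mul, eval_sub, eval_X, eval_C]
  nlinarith [mul_pos hμ (sub_pos.2 hν)]

/-- The number of zeros in the right interval decreases strictly with the Van Vleck zero. -/
theorem ncard_roots_right_lt (hα : StrictMono α) (hρ : ∀ i, 0 < ρ i) (hk : 1 ≤ k) {ν ν' : ℝ}
    (hν : ν < ν') {S T : ℝ[X]} (hS : IsStieltjes α ρ k ν S) (hT : IsStieltjes α ρ k ν' T) :
    {x ∈ Set.Ioo (α 1) (α 2) | T.IsRoot x}.ncard <
      {x ∈ Set.Ioo (α 1) (α 2) | S.IsRoot x}.ncard := by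
  have hμ : (0 : ℝ) < k * (k - 1) + k * (ρ 0 + ρ 1 + ρ 2) := by
    simpa using lame_mu_lt hρ (m := 0) hk
  refine ncard_roots_lt_of_wronskian (hα (by decide)) (continuous_lameWeight α ρ hρ)
    (lameWeight_nonneg α ρ) ?_ hT.ne_zero hS.ne_zero
    (fun x hx => hasDerivAt_lameWronskian hT.solvesLame hS.solvesLame
      (ne_singular_of_lameA_eval_ne_zero (lameA_eval_neg hα hx).ne))
    (lameWeight_apply_singular α ρ hρ 1) (lameWeight_apply_singular α ρ hρ 2)
  intro x hx
  have hA := lameA_eval_neg hα hx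
  refine mul_pos (lameWeight_pos α ρ (ne_singular_of_lameA_eval_ne_zero hA.ne))
    (div_pos_of_neg_of_neg ?_ hA)
  simp only [eval_mul, eval_sub, eval_X, eval_C]
  nlinarith [mul_pos hμ (sub_pos.2 hν)]

/-- Where `V / A` is positive, the function `P * S * S'` is strictly increasing. -/
theorem weight_mul_self_mul_derivative_lt (hρ : ∀ i, 0 < ρ i) {V S : ℝ[X]}
    (hS : SolvesLame α ρ V S) (hS0 : S ≠ 0) {a b : ℝ} (hab : a < b)
    (hV : ∀ x ∈ Set.Ioo a b, 0 < V.eval x / (lameA α).eval x) :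
    lameWeight α ρ a * (S.eval a * S.derivative.eval a) <
      lameWeight α ρ b * (S.eval b * S.derivative.eval b) := by
  -- At a singular point the quotient has value `0` by the convention for division by zero, so `hV`
  -- excludes such points.
  have hsing : ∀ x ∈ Set.Ioo a b, ∀ j, x ≠ α j := fun x hx =>
    ne_singular_of_lameA_eval_ne_zero fun h => by simpa [h] using hV x hx
  set F : ℝ → ℝ := fun y => lameWeight α ρ y * (S.eval y * S.derivative.eval y) with hF
  have hderiv : ∀ x ∈ Set.Ioo a b, HasDerivAt F (lameWeight α ρ x *
      (S.derivative.eval x ^ 2 + V.eval x / (lameA α).eval x * S.eval x ^ 2)) x :=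
    fun x hx => hasDerivAt_weight_mul_self_mul_derivative hS (hsing x hx)
  have hcont : ContinuousOn F (Set.Icc a b) := by
    have := continuous_lameWeight α ρ hρ
    simp only [hF]; fun_prop
  have hmono : MonotoneOn F (Set.Icc a b) := by
    refine monotoneOn_of_deriv_nonneg (convex_Icc a b) hcont ?_ ?_
    · rw [interior_Icc]
      exact fun x hx => (hderiv x hx).differentiableAt.differentiableWithinAt
    · intro x hx
      rw [interior_Icc] at hx
      rw [(hderiv x hx).deriv]
      have := hV x hx
      have := lameWeight_nonneg α ρ x
      positivity
  have haI := Set.left_mem_Icc.2 hab.le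
  have hbI := Set.right_mem_Icc.2 hab.le
  -- Equality would make `F` constant, so its derivative, a positive weight times a sum of
  -- nonnegative terms, forces `S = 0` on an interval.
  refine (hmono haI hbI hab.le).lt_of_ne fun heq => hS0 ?_
  refine eq_zero_of_infinite_isRoot S ((Set.Ioo_infinite hab).mono fun x hx => ?_)
  have hconst : ∀ y ∈ Set.Ioo a b, F y = F a := fun y hy =>
    le_antisymm (((hmono (Set.Ioo_subset_Icc_self hy) hbI hy.2.le)).trans heq.ge)
      (hmono haI (Set.Ioo_subset_Icc_self hy) hy.1.le)
  have h0 : HasDerivAt F 0 x := (hasDerivAt_const x (F a)).congr_of_eventuallyEq <|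
    (isOpen_Ioo.mem_nhds hx : Set.Ioo a b ∈ nhds x) |> Filter.mem_of_superset <| hconst
  have h1 := (hderiv x hx).unique h0
  have h2 := (mul_eq_zero.1 h1).resolve_left (lameWeight_pos α ρ (hsing x hx)).ne'
  have h3 := hV x hx
  have h4 : V.eval x / (lameA α).eval x * S.eval x ^ 2 = 0 :=
    le_antisymm (by nlinarith [sq_nonneg (S.derivative.eval x)]) (by positivity)
  exact pow_eq_zero_iff (two_ne_zero) |>.1 ((mul_eq_zero.1 h4).resolve_left h3.ne')

/-- A Stieltjes polynomial has no zero between the middle singular point and its Van Vleck zero. -/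
theorem IsStieltjes.not_isRoot_uIcc (hα : StrictMono α) (hρ : ∀ i, 0 < ρ i) (hk : 1 ≤ k) {ν : ℝ}
    {S : ℝ[X]} (hS : IsStieltjes α ρ k ν S) : ∀ x ∈ Set.uIcc (α 1) ν, ¬ S.IsRoot x := by
  have hμ : (0 : ℝ) < k * (k - 1) + k * (ρ 0 + ρ 1 + ρ 2) := by
    simpa using lame_mu_lt hρ (m := 0) hk
  have h01 : α 0 < α 1 := hα (by decide)
  have h12 : α 1 < α 2 := hα (by decide)
  have hright : ∀ x, α 1 < x → x ≤ ν → x ≤ α 2 →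
      0 < lameWeight α ρ x * (S.eval x * S.derivative.eval x) := by
    intro x hx hxν hx2
    have := weight_mul_self_mul_derivative_lt hρ hS.solvesLame hS.ne_zero hx fun y hy => by
      refine div_pos_of_neg_of_neg ?_ (lameA_eval_neg hα ⟨hy.1, hy.2.trans_le hx2⟩)
      simp only [eval_mul, eval_sub, eval_X, eval_C]
      exact mul_neg_of_pos_of_neg hμ (by linarith [hy.2])
    rwa [lameWeight_apply_singular α ρ hρ 1, zero_mul] at this
  have hleft : ∀ x, x < α 1 → ν ≤ x → α 0 ≤ x →
      lameWeight α ρ x * (S.eval x * S.derivative.eval x) < 0 := by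
    intro x hx hxν hx0
    have := weight_mul_self_mul_derivative_lt hρ hS.solvesLame hS.ne_zero hx fun y hy => by
      refine div_pos ?_ (lameA_eval_pos hα ⟨hx0.trans_lt hy.1, hy.2⟩)
      simp only [eval_mul, eval_sub, eval_X, eval_C]
      exact mul_pos hμ (by linarith [hy.1])
    rwa [lameWeight_apply_singular α ρ hρ 1, zero_mul] at this
  -- If `ν` lay beyond an outer singular point, strict monotonicity would reach that point, where
  -- `P` vanishes. So `ν` lies in `(α 0, α 2)`.
  have hν2 : ν < α 2 := by
    by_contra! h
    simpa [lameWeight_apply_singular α ρ hρ 2] using hright (α 2) h12 h le_rfl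
  have hν0 : α 0 < ν := by
    by_contra! h
    simpa [lameWeight_apply_singular α ρ hρ 0] using hleft (α 0) h01 h le_rfl
  intro x hx hroot
  have hroot' : S.eval x = 0 := hroot
  rcases lt_trichotomy x (α 1) with h | rfl | h
  · have hνx : ν ≤ x := by
      rcases Set.mem_uIcc.1 hx with h' | h'
      · exact absurd h'.1 (not_le.2 h)
      · exact h'.1
    simpa [hroot'] using hleft x h hνx (hν0.le.trans hνx)
  · exact hS.eval_middle_ne_zero hα hρ hroot'
  · have hxν : x ≤ ν := by
      rcases Set.mem_uIcc.1 hx with h' | h'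
      · exact h'.2
      · exact absurd h'.2 (not_le.2 h)
    simpa [hroot'] using hright x h hxν (hxν.trans hν2.le)

/-- A strictly increasing self-map of a finite chain is onto, and an increasing map is determined by
its range. -/
theorem eq_val_of_strictMono_of_le {f : Fin (k + 1) → ℕ} (hf : StrictMono f)
    (hle : ∀ i, f i ≤ k) (j : Fin (k + 1)) : f j = j := by
  let g : Fin (k + 1) → Fin (k + 1) := fun i => ⟨f i, Nat.lt_succ_of_le (hle i)⟩
  have hg : StrictMono g := fun i j hij => hf hij
  have : g = id := hg.range_inj strictMono_id |>.1 <| by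
    rw [(Finite.injective_iff_surjective.1 hg.injective).range_eq, Set.range_id]
  exact congrArg Fin.val (congrFun this j)

/-- The left zero count of a chosen Stieltjes polynomial injects the Van Vleck zeros into `{0, …,
k}`; the eigenvalues give the matching lower bound. -/
theorem vanVleckZeros_finite_ncard (hα : StrictMono α) (hρ : ∀ i, 0 < ρ i) (hk : 1 ≤ k) :
    (vanVleckZeros α ρ k).Finite ∧ (vanVleckZeros α ρ k).ncard = k + 1 := by
  choose! S hS using fun (ν : ℝ) (h : ν ∈ vanVleckZeros α ρ k) => h
  let n : ℝ → ℕ := fun ν => {x ∈ Set.Ioo (α 0) (α 1) | (S ν).IsRoot x}.ncard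
  have hn : StrictMonoOn n (vanVleckZeros α ρ k) := fun ν h ν' h' hlt =>
    ncard_roots_left_lt hα hρ hk hlt (hS ν h) (hS ν' h')
  have hmaps : Set.MapsTo n (vanVleckZeros α ρ k) (Set.Iio (k + 1)) := fun ν h =>
    Nat.lt_succ_of_le ((ncard_roots_Ioo_le (hS ν h).ne_zero _ _).trans (hS ν h).natDegree_eq.le)
  have hfin := Set.Finite.of_injOn hmaps hn.injOn (Set.finite_Iio _)
  refine ⟨hfin, le_antisymm ?_ ?_⟩
  · have := Set.ncard_le_ncard_of_injOn n hmaps hn.injOn (Set.finite_Iio _)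
    rwa [← Finset.coe_Iio, Set.ncard_coe_finset, Nat.card_Iio] at this
  · obtain ⟨ν, hinj, hmem⟩ := exists_vanVleckZeros hα hρ hk
    have := Set.ncard_le_ncard (Set.range_subset_iff.2 hmem) hfin
    rwa [← Set.image_univ, Set.ncard_image_of_injective _ hinj, Set.ncard_univ,
      Nat.card_eq_fintype_card, Fintype.card_fin] at this

end Zeros

/-- Indices are shifted by one: `α 0 < α 1 < α 2` are the three singular points, and the
label `j : Fin (k + 1)` stands for the `(j + 1)`-st Van Vleck zero in increasing order. -/
theorem theorem1 (α ρ : Fin 3 → ℝ) (hα : StrictMono α) (hρ : ∀ i, 0 < ρ i)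
    (k : ℕ) (hk : 1 ≤ k) :
    ∃ ν : Fin (k + 1) → ℝ, StrictMono ν ∧ Set.range ν = vanVleckZeros α ρ k ∧
      ∀ (j : Fin (k + 1)) (S : Polynomial ℝ), IsStieltjes α ρ k (ν j) S →
        {x ∈ Set.Ioo (α 0) (α 1) | S.IsRoot x}.ncard = (j : ℕ) ∧
        {x ∈ Set.Ioo (α 1) (α 2) | S.IsRoot x}.ncard = k - (j : ℕ) ∧
        ∀ x ∈ Set.uIcc (α 1) (ν j), ¬ S.IsRoot x := by
  obtain ⟨hfin, hcard⟩ := vanVleckZeros_finite_ncard hα hρ hk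
  rw [Set.ncard_eq_toFinset_card _ hfin] at hcard
  have hrange : Set.range (hfin.toFinset.orderEmbOfFin hcard) = vanVleckZeros α ρ k := by simp
  refine ⟨hfin.toFinset.orderEmbOfFin hcard, (Finset.orderEmbOfFin _ hcard).strictMono, hrange, ?_⟩
  set ν := hfin.toFinset.orderEmbOfFin hcard
  intro j S hS
  have hex : ∀ i, ∃ T, IsStieltjes α ρ k (ν i) T := fun i => by
    have : ν i ∈ vanVleckZeros α ρ k := hrange ▸ Set.mem_range_self i
    exact this
  choose T₀ hT₀ using hex
  -- The given `S` is placed in the chosen family at `j`, so the counts hold for every Stieltjes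
  -- polynomial, not just a chosen one.
  let T := Function.update T₀ j S
  have hT : ∀ i, IsStieltjes α ρ k (ν i) (T i) := by
    intro i
    by_cases h : i = j
    · subst h; simpa [T] using hS
    · simpa [T, h] using hT₀ i
  have hTj : T j = S := Function.update_self ..
  have hle : ∀ i (a b : ℝ), {x ∈ Set.Ioo a b | (T i).IsRoot x}.ncard ≤ k := fun i a b =>
    (ncard_roots_Ioo_le (hT i).ne_zero a b).trans (hT i).natDegree_eq.le
  have hL := eq_val_of_strictMono_of_le
    (f := fun i => {x ∈ Set.Ioo (α 0) (α 1) | (T i).IsRoot x}.ncard)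
    (fun i i' h => ncard_roots_left_lt hα hρ hk (ν.strictMono h) (hT i) (hT i'))
    (fun i => hle i _ _) j
  -- The right count decreases, so its complement in `k` increases; the bound `hle` keeps the
  -- truncated subtraction exact.
  have hR := eq_val_of_strictMono_of_le
    (f := fun i => k - {x ∈ Set.Ioo (α 1) (α 2) | (T i).IsRoot x}.ncard)
    (fun i i' h => by
      have := ncard_roots_right_lt hα hρ hk (ν.strictMono h) (hT i) (hT i')
      have := hle i (α 1) (α 2)
      simp only
      omega)
    (fun i => Nat.sub_le _ _) j
  have hRle := hle j (α 1) (α 2)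
  simp only [hTj] at hL hR hRle
  exact ⟨hL, by omega, hS.not_isRoot_uIcc hα hρ hk⟩
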